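/- Let $\mathcal M$ be a von Neumann algebra acting on a complex Hilbert space $\mathcal H$, let $A\in\mathcal M$ be positive and well-supported, i.e. $\sigma(A)\setminus\{0\}$ is closed, where $\sigma(A)$ is the spectrum of $A$ in $\mathcal M$. For $T\in\mathcal M$ put $$\|T\|_A=\sup\Big\{\sqrt{f(T^*AT)} : f \text{ a positive linear functional on } \mathcal M \text{ with } f(A)=1\Big\}\in[0,\infty]$$ (with $\sup\emptyset=0$), and let $\mathcal M^A=\{T\in\mathcal M:\|T\|_A<\infty\}$. An element $T\in\mathcal M^A$ is called $A$-invertible in $\mathcal M^A$ if there is $R\in\mathcal M^A$ with $ATR=ART=A$, and its $A$-spectrum is $$\sigma_A(T)=\{\lambda\in\mathbb C:\lambda I-T\text{ is not }A\text{-invertible in }\mathcal M^A\}.$$ Let $S,T\in\mathcal M^A$. Then $\sigma_A(SX)=\sigma_A(TX)$ for all $X\in\mathcal M^A$ if and only if $AS=AT$. -/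

import Mathlib

noncomputable section

namespace ASpectrum

open scoped ENNReal ComplexOrder

variable {H : Type*} [NormedAddCommGroup H] [InnerProductSpace ℂ H] [CompleteSpace H]

/-- The underlying unital `*`-algebra of a von Neumann algebra `M` acting on `H`; its elements are
the operators belonging to `M`. -/
abbrev Elt (M : VonNeumannAlgebra H) : Type _ := M.toStarSubalgebra

variable {M : VonNeumannAlgebra H}

/-- `T` is a positive element of `M`: it is positive as an operator on `H`. -/
def IsPos (T : Elt M) : Prop := (T : H →L[ℂ] H).IsPositive

/-- A bounded linear functional on `M` is positive if it takes nonnegative (real) values at the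
positive elements. -/
def IsPosFunctional (f : StrongDual ℂ (Elt M)) : Prop :=
  ∀ T : Elt M, IsPos T → 0 ≤ f T

/-- The set of all positive functionals `f` on `M` with `f A = 1`. -/
def states (A : Elt M) : Set (StrongDual ℂ (Elt M)) :=
  {f | IsPosFunctional f ∧ f A = 1}

/-- `‖T‖_A`, the supremum in `[0, ∞]` of `√(f (T* A T))` over the positive functionals `f` with
`f A = 1`. The numbers `f (T* A T)` are real and nonnegative. -/
def seminorm (A T : Elt M) : ℝ≥0∞ :=
  ⨆ f ∈ states A, ENNReal.ofReal (√ (f (star T * A * T)).re)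

/-- `M^A`, the set of `A`-bounded elements of `M`. -/
def bounded (A : Elt M) : Set (Elt M) := {T | seminorm A T < ∞}

/-- `T` is `A`-invertible in `M^A`. -/
def IsAInvertible (A T : Elt M) : Prop :=
  ∃ S ∈ bounded A, A * T * S = A ∧ A * S * T = A

/-- The `A`-spectrum of `T`. -/
def aSpectrum (A T : Elt M) : Set ℂ :=
  {z | ¬ IsAInvertible A (z • (1 : Elt M) - T)}

/-- `A` is well-supported: `σ(A) \ {0}` is closed, where `σ(A)` is the spectrum of `A` in `M`. -/
def IsWellSupported (A : Elt M) : Prop := IsClosed (spectrum ℂ A \ {0})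

end ASpectrum

end

/-! Well-supportedness gives `B` with `A * B * A = A`, so `P = B * A` is an idempotent with the same
kernel as `A`. An element `T` is `A`-bounded exactly when it preserves this kernel, and for `z ≠ 0`
`A`-invertibility of `z - T` is ordinary invertibility of `z - P T P`. Equal `A`-spectra, read at `z
= 1`, thus say that `a = P S P` and `b = P T P` satisfy `SameInvertibility`.

That relation forces `a = b`. It survives multiplication on either side and adjoints, and keeps the
nonzero spectrum. If `a` is a projection, spectra in `{0, 1}` give `b = a`. Support projections of
spectral cutoffs extend this to `(b - a) * a = 0` for `a ≥ 0`, and `a * star a` handles general `a`.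
Conversely, `A`-invertibility of `V` depends only on `A * V`. -/

section SameInvertibility

/-- `a` and `b` have the same invertibility behaviour under right multiplication: `1 - a x` is
invertible exactly when `1 - b x` is. Equivalently, `a x` and `b x` have the same nonzero spectrum
for all `x`. -/
def SameInvertibility {R : Type*} [Ring R] (a b : R) : Prop :=
  ∀ x, IsUnit (1 - a * x) ↔ IsUnit (1 - b * x)

theorem isUnit_one_sub_mul_of_swap {R : Type*} [Ring R] {x y : R} (h : IsUnit (1 - x * y)) :
    IsUnit (1 - y * x) := by
  obtain ⟨u, hu⟩ := h
  have h1 : (1 - x * y) * ↑u⁻¹ = 1 := by rw [← hu]; simp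
  have h2 : ↑u⁻¹ * (1 - x * y) = 1 := by rw [← hu]; simp
  refine ⟨⟨1 - y * x, 1 + y * ↑u⁻¹ * x, ?_, ?_⟩, rfl⟩
  · calc (1 - y * x) * (1 + y * ↑u⁻¹ * x)
        = 1 - y * x + y * ((1 - x * y) * ↑u⁻¹) * x := by noncomm_ring
      _ = 1 := by rw [h1]; noncomm_ring
  · calc (1 + y * ↑u⁻¹ * x) * (1 - y * x)
        = 1 - y * x + y * (↑u⁻¹ * (1 - x * y)) * x := by noncomm_ring
      _ = 1 := by rw [h2]; noncomm_ring

theorem isUnit_one_sub_mul_swap {R : Type*} [Ring R] (x y : R) :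
    IsUnit (1 - x * y) ↔ IsUnit (1 - y * x) :=
  ⟨isUnit_one_sub_mul_of_swap, isUnit_one_sub_mul_of_swap⟩

/-- Every self-adjoint element `h` has a support projection: `e h = h`, and `e` is annihilated
on the left by whatever annihilates `h`. -/
def HasSupportProjections (R : Type*) [CStarAlgebra R] : Prop :=
  ∀ h : R, IsSelfAdjoint h → ∃ e : R, IsStarProjection e ∧ e * h = h ∧ ∀ d, d * h = 0 → d * e = 0

namespace SameInvertibility

/-! ### Stability of the relation in rings -/

section Ring

variable {R : Type*} [Ring R] {a b : R}

theorem symm (h : SameInvertibility a b) : SameInvertibility b a := fun x => (h x).symm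

theorem mul_right (h : SameInvertibility a b) (u : R) : SameInvertibility (a * u) (b * u) :=
  fun x => by simpa only [mul_assoc] using h (u * x)

theorem mul_left (h : SameInvertibility a b) (u : R) : SameInvertibility (u * a) (u * b) :=
  fun x => by
    rw [mul_assoc, mul_assoc, isUnit_one_sub_mul_swap u, isUnit_one_sub_mul_swap u, mul_assoc,
      mul_assoc]
    exact h (x * u)

theorem star [StarRing R] (h : SameInvertibility a b) :
    SameInvertibility (star a) (star b) := fun x => by
  rw [← isUnit_star, ← isUnit_star (a := 1 - Star.star b * x)]
  simp only [star_sub, star_one, star_mul, star_star]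
  rw [isUnit_one_sub_mul_swap, isUnit_one_sub_mul_swap (Star.star x)]
  exact h _

theorem mem_spectrum_iff [Algebra ℂ R] (h : SameInvertibility a b) {z : ℂ} (hz : z ≠ 0) :
    z ∈ spectrum ℂ a ↔ z ∈ spectrum ℂ b := by
  have key : ∀ c : R, algebraMap ℂ R z - c = algebraMap ℂ R z * (1 - c * algebraMap ℂ R z⁻¹) := by
    intro c
    rw [← Algebra.commutes z⁻¹ c, mul_sub, ← mul_assoc, ← map_mul, mul_inv_cancel₀ hz]
    simp
  have hu : IsUnit (algebraMap ℂ R z) := (IsUnit.mk0 z hz).map _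
  rw [spectrum.mem_iff, spectrum.mem_iff, key a, key b]
  obtain ⟨u, hu⟩ := hu
  rw [← hu, Units.isUnit_units_mul, Units.isUnit_units_mul]
  exact not_congr (h _)

theorem spectrum_subset [Algebra ℂ R] (h : SameInvertibility a b) {s : Set ℂ}
    (hs : spectrum ℂ a ⊆ s) (h0 : 0 ∈ s) : spectrum ℂ b ⊆ s := fun z hz => by
  rcases eq_or_ne z 0 with rfl | hz0
  · exact h0
  · exact hs ((h.mem_spectrum_iff hz0).2 hz)

end Ring

/-! ### Rigidity of the relation in C*-algebras -/

section CStarAlgebra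

variable {R : Type*} [CStarAlgebra R] {a b e c : R}

theorem eq_zero_of_spectrum_subset [IsStarNormal a] (h : spectrum ℂ a ⊆ {0}) : a = 0 := by
  rw [← cfc_id ℂ a]
  refine (cfc_congr (g := fun _ => 0) fun z hz => ?_).trans (cfc_const_zero ℂ a)
  exact h hz

theorem eq_zero (h : SameInvertibility 0 b) : b = 0 := by
  rw [← CStarRing.mul_star_self_eq_zero_iff]
  have h' := h.mul_right (Star.star b)
  rw [zero_mul] at h'
  have : IsStarNormal (b * Star.star b) := (IsSelfAdjoint.mul_star_self b).isStarNormal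
  exact eq_zero_of_spectrum_subset <| h'.spectrum_subset (by
    intro z hz
    by_contra hz0
    refine hz ?_
    rw [spectrum.mem_resolventSet_iff, sub_zero]
    exact (IsUnit.mk0 z hz0).map (algebraMap ℂ R)) rfl

/-- Both `star c` and `c * star c` have nonzero spectrum in `{1}`, so the self-adjoint `c * star c`
is a projection. Its complement in `e` kills `c`, hence is related to `0`. -/
theorem mul_star_eq_of_isStarProjection (he : IsStarProjection e) (h : SameInvertibility e c)
    (hec : e * c = c) (hce : c * e = c) : c * Star.star c = e := by
  have hs : IsStarProjection (c * Star.star c) := by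
    rw [isStarProjection_iff_spectrum_subset_and_isStarNormal]
    refine ⟨?_, (IsSelfAdjoint.mul_star_self c).isStarNormal⟩
    have h1 : spectrum ℂ e ⊆ {0, 1} :=
      (isStarProjection_iff_spectrum_subset_and_isStarNormal.1 he).1
    have h2 : SameInvertibility (e * e) (Star.star c) := by
      have := h.star
      rwa [he.isSelfAdjoint.star_eq, ← he.isIdempotentElem.eq] at this
    have h3 := h.mul_right (Star.star c)
    rw [show e * Star.star c = Star.star c by
      conv_rhs => rw [← hce, star_mul, he.isSelfAdjoint.star_eq]] at h3
    rw [he.isIdempotentElem.eq] at h2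
    exact h3.spectrum_subset (h2.spectrum_subset h1 (by simp)) (by simp)
  have hc : c * Star.star c * c = c := by
    rw [← sub_eq_zero, ← CStarRing.mul_star_self_eq_zero_iff]
    have := hs.isIdempotentElem.eq
    simp only [star_sub, star_mul, star_star]
    calc _ = c * Star.star c * (c * Star.star c) * (c * Star.star c)
            - c * Star.star c * (c * Star.star c) - c * Star.star c * (c * Star.star c)
            + c * Star.star c := by noncomm_ring
      _ = 0 := by rw [this, this]; abel
  have hf := h.mul_left (e - c * Star.star c)
  have h1 : (e - c * Star.star c) * c = 0 := by rw [sub_mul, hec, hc, sub_self]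
  have h2 : (e - c * Star.star c) * e = e - c * Star.star c := by
    have : Star.star c * e = Star.star c := by
      conv_rhs => rw [← hec, star_mul, he.isSelfAdjoint.star_eq]
    rw [sub_mul, mul_assoc, this, he.isIdempotentElem.eq]
  rw [h1, h2] at hf
  exact (sub_eq_zero.1 hf.symm.eq_zero).symm

theorem eq_of_isStarProjection (he : IsStarProjection e) (h : SameInvertibility e c) : c = e := by
  have hec : e * c = c := by
    have := h.mul_left (1 - e)
    rw [sub_mul, one_mul, he.isIdempotentElem.eq, sub_self] at this
    have := this.eq_zero
    rw [sub_mul, one_mul, sub_eq_zero] at this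
    exact this.symm
  have hce : c * e = c := by
    have := h.mul_right (1 - e)
    rw [mul_sub, mul_one, he.isIdempotentElem.eq, sub_self] at this
    have := this.eq_zero
    rw [mul_sub, mul_one, sub_eq_zero] at this
    exact this.symm
  have h1 := mul_star_eq_of_isStarProjection he h hec hce
  have hs : SameInvertibility e (Star.star c) := by
    simpa only [he.isSelfAdjoint.star_eq] using h.star
  have h2 := mul_star_eq_of_isStarProjection he hs
    (by conv_rhs => rw [← hce, star_mul, he.isSelfAdjoint.star_eq])
    (by conv_rhs => rw [← hec, star_mul, he.isSelfAdjoint.star_eq])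
  rw [star_star] at h2
  have hc : IsStarProjection c := by
    rw [isStarProjection_iff_spectrum_subset_and_isStarNormal]
    exact ⟨h.spectrum_subset (isStarProjection_iff_spectrum_subset_and_isStarNormal.1 he).1
      (by simp), ⟨h2.trans h1.symm⟩⟩
  rw [hc.isSelfAdjoint.star_eq, hc.isIdempotentElem.eq] at h1
  exact h1

/-- On the support `e` of the cutoff `(a - δ)₊`, `a` has right inverse `y`. Thus `e = a y e` is
related to `b y e`, and the projection case makes them equal. Then let `δ → 0`. -/
theorem sub_mul_eq_zero_of_nonneg (hR : HasSupportProjections R) (ha : IsSelfAdjoint a)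
    (ha' : ∀ x ∈ spectrum ℝ a, 0 ≤ x) (h : SameInvertibility a b) : (b - a) * a = 0 := by
  have key : ∀ δ : ℝ, 0 < δ → (b - a) * cfc (fun x : ℝ => max (x - δ) 0) a = 0 := by
    intro δ hδ
    set k := cfc (fun x : ℝ => max (x - δ) 0) a with hk
    set y := cfc (fun x : ℝ => (max x δ)⁻¹) a with hy
    set w := cfc (fun x : ℝ => max x δ) a with hw
    have hinv : Continuous fun x : ℝ => (max x δ)⁻¹ :=
      (continuous_id.max continuous_const).inv₀ fun x => (lt_max_of_lt_right hδ).ne'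
    have hyw : y * k * w = k := by
      rw [hy, hk, hw, ← cfc_mul _ _ a hinv.continuousOn (by fun_prop),
        ← cfc_mul (fun x : ℝ => (max x δ)⁻¹ * max (x - δ) 0) _ a
          (hinv.continuousOn.mul (by fun_prop)) (by fun_prop)]
      refine cfc_congr fun x _ => ?_
      have : max x δ ≠ 0 := (lt_max_of_lt_right hδ).ne'
      field_simp
    have hayk : a * y * k = k := by
      rw [hy, hk]
      nth_rewrite 1 [← cfc_id' ℝ a]
      rw [← cfc_mul _ _ a (by fun_prop) hinv.continuousOn,
        ← cfc_mul (fun x : ℝ => x * (max x δ)⁻¹) _ a (ContinuousOn.mul (by fun_prop) hinv.continuousOn) (by fun_prop)]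
      refine cfc_congr fun x _ => ?_
      rcases le_total x δ with hx | hx
      · simp [hx]
      · have : x ≠ 0 := (hδ.trans_le hx).ne'
        simp [hx, this]
    obtain ⟨e, he, hek, hd⟩ := hR k (cfc_predicate _ a)
    have haye : a * y * e = e := by
      have := hd (a * y - 1) (by rw [sub_mul, hayk, one_mul, sub_self])
      rwa [sub_mul, one_mul, sub_eq_zero] at this
    have hs : SameInvertibility e (b * (y * e)) := by
      have := h.mul_right (y * e)
      rwa [← mul_assoc a, haye] at this
    have hbye := eq_of_isStarProjection he hs
    -- The factor `w` inverts `y`; writing `k = y (e k) w` puts `y e` next to `b - a` without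
    -- commuting `e` past `y`.
    calc (b - a) * k = (b * (y * e) - a * y * e) * k * w := by
          nth_rewrite 1 [← hyw, ← hek]
          noncomm_ring
      _ = 0 := by rw [hbye, haye]; simp
  rw [← norm_le_zero_iff]
  refine le_of_forall_pos_le_add fun ε hε => ?_
  set δ := ε / (‖b - a‖ + 1)
  have hδ : 0 < δ := by positivity
  have hle : ‖a - cfc (fun x : ℝ => max (x - δ) 0) a‖ ≤ δ := by
    nth_rewrite 1 [← cfc_id' ℝ a]
    rw [← cfc_sub _ _ a (by fun_prop) (by fun_prop)]
    refine norm_cfc_le hδ.le fun x hx => ?_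
    have := ha' x hx
    rw [Real.norm_eq_abs, abs_le]
    rcases le_total (x - δ) 0 with h | h
    · rw [max_eq_right h]; constructor <;> linarith
    · rw [max_eq_left h]; constructor <;> linarith
  calc ‖(b - a) * a‖ = ‖(b - a) * (a - cfc (fun x : ℝ => max (x - δ) 0) a)‖ := by
        rw [mul_sub, key δ hδ, sub_zero]
    _ ≤ ‖b - a‖ * δ := (norm_mul_le _ _).trans (by gcongr)
    _ ≤ (‖b - a‖ + 1) * δ := by gcongr; linarith
    _ = 0 + ε := by simp only [δ]; field_simp; ring

theorem mul_eq_zero_of_mul_mul_star_eq_zero {x : R} (h : x * (a * Star.star a) = 0) :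
    x * a = 0 := by
  rw [← CStarRing.mul_star_self_eq_zero_iff, star_mul, ← mul_assoc, mul_assoc x, h, zero_mul]

/-- The positive case applied to `a * star a` gives `(b - a) a* a a* = 0`; the two trailing factors
cancel one at a time. -/
theorem mul_star_eq (hR : HasSupportProjections R) (h : SameInvertibility a b) :
    b * Star.star a = a * Star.star a := by
  have h1 : (b * Star.star a - a * Star.star a) * (a * Star.star a) = 0 :=
    sub_mul_eq_zero_of_nonneg hR (.mul_star_self a)
      (by simpa using spectrum_star_mul_self_nonneg (b := Star.star a))
      (h.mul_right (Star.star a))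
  rw [← sub_eq_zero, ← sub_mul]
  rw [← sub_mul] at h1
  have h2 := mul_eq_zero_of_mul_mul_star_eq_zero h1
  refine mul_eq_zero_of_mul_mul_star_eq_zero ?_
  rwa [star_star, ← mul_assoc]

theorem eq (hR : HasSupportProjections R) (h : SameInvertibility a b) : a = b := by
  have h1 := h.mul_star_eq hR
  have h2 := h.symm.mul_star_eq hR
  rw [← sub_eq_zero, ← CStarRing.mul_star_self_eq_zero_iff, star_sub, sub_mul, mul_sub, mul_sub,
    h1, h2]
  abel

end CStarAlgebra

end SameInvertibility

end SameInvertibility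

/-! ### Generalized inverse, support projections and `A`-bounded elements -/

noncomputable section
namespace ASpectrum
open scoped ENNReal ComplexOrder
open ContinuousLinearMap

theorem exists_mul_mul_eq_of_isClosed_spectrum_diff {R : Type*} [CStarAlgebra R] {a : R}
    [IsStarNormal a] (h : IsClosed (spectrum ℂ a \ {0})) : ∃ b, a * b * a = a := by
  have hc : ContinuousOn (fun z : ℂ => z⁻¹) (spectrum ℂ a) := by
    intro z hz
    rcases eq_or_ne z 0 with rfl | hz0
    -- A point `0` of the spectrum is isolated, so the convention `0⁻¹ = 0` does not break
    -- continuity.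
    · refine (continuousWithinAt_singleton (f := fun z : ℂ => z⁻¹) (x := 0)).mono_of_mem_nhdsWithin
        ?_
      refine mem_nhdsWithin.2 ⟨(spectrum ℂ a \ {0})ᶜ, h.isOpen_compl, by simp, ?_⟩
      rintro w ⟨hw, hw'⟩
      by_contra hw0
      exact hw ⟨hw', hw0⟩
    · exact (continuousAt_inv₀ hz0).continuousWithinAt
  have hmul : cfc (fun z : ℂ => z) a * cfc (fun z : ℂ => z⁻¹) a * cfc (fun z : ℂ => z) a
      = cfc (fun z : ℂ => z) a := by
    rw [← cfc_mul (fun z : ℂ => z) _ a (by fun_prop) hc,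
      ← cfc_mul (fun z : ℂ => z * z⁻¹) _ a (ContinuousOn.mul (by fun_prop) hc) (by fun_prop)]
    exact cfc_congr fun z _ => mul_inv_mul_cancel z
  rw [cfc_id' ℂ a] at hmul
  exact ⟨_, hmul⟩

variable {H : Type*} [NormedAddCommGroup H] [InnerProductSpace ℂ H] [CompleteSpace H]
variable {M : VonNeumannAlgebra H}

theorem isClosed_coe (M : VonNeumannAlgebra H) :
    IsClosed (M.toStarSubalgebra : Set (H →L[ℂ] H)) := by
  rw [VonNeumannAlgebra.coe_toStarSubalgebra, ← VonNeumannAlgebra.centralizer_centralizer]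
  exact Set.isClosed_centralizer _

instance : CStarAlgebra (Elt M) :=
  have : IsClosed (M.toStarSubalgebra : Set (H →L[ℂ] H)) := isClosed_coe M
  StarSubalgebra.cstarAlgebra M.toStarSubalgebra

/-- The projection onto the closure of the range of `h` works: the commutant leaves that range
invariant, so the projection lies in `M`. -/
theorem hasSupportProjections : HasSupportProjections (Elt M) := by
  rintro ⟨h, hM⟩ -
  let K : Submodule ℂ H := h.range.topologicalClosure
  have hmem : ∀ x, h x ∈ K := fun x => h.range.le_topologicalClosure ⟨x, rfl⟩
  have hK : IsStarProjection K.starProjection := isStarProjection_starProjection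
  have hKM : K.starProjection ∈ M := by
    rw [VonNeumannAlgebra.IsStarProjection.mem_iff hK]
    intro y hy
    rw [Submodule.range_starProjection, Module.End.mem_invtSubmodule]
    refine Submodule.topologicalClosure_minimal _ ?_
      (h.range.isClosed_topologicalClosure.preimage y.continuous)
    rintro _ ⟨x, rfl⟩
    have := VonNeumannAlgebra.mem_commutant_iff.1 hy h hM
    have hyx : y (h x) = h (y x) := (DFunLike.congr_fun this x).symm
    change y (h x) ∈ K
    exact hyx ▸ hmem (y x)
  refine ⟨⟨K.starProjection, hKM⟩, ⟨Subtype.ext hK.isIdempotentElem.eq,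
    Subtype.ext hK.isSelfAdjoint⟩, Subtype.ext ?_, ?_⟩
  · ext x
    exact Submodule.starProjection_eq_self_iff.2 (hmem x)
  · rintro ⟨d, hd⟩ h0
    have h0' : d * h = 0 := congrArg Subtype.val h0
    refine Subtype.ext (ContinuousLinearMap.ext fun x => ?_)
    have hle : K ≤ d.ker := Submodule.topologicalClosure_minimal _
      (by rintro _ ⟨x, rfl⟩; exact DFunLike.congr_fun h0' x) d.isClosed_ker
    exact hle (K.starProjection_apply_mem x)

/-- The vector functional `T ↦ ⟪x, T x⟫`. -/
def vectorFunctional (x : H) : StrongDual ℂ (Elt M) where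
  toFun T := inner ℂ x ((T : H →L[ℂ] H) x)
  map_add' S T := by simp
  map_smul' c T := by simp
  cont := by fun_prop

theorem vectorFunctional_apply (x : H) (T : Elt M) :
    vectorFunctional x T = inner ℂ x ((T : H →L[ℂ] H) x) := rfl

theorem isPosFunctional_vectorFunctional (x : H) :
    IsPosFunctional (vectorFunctional x : StrongDual ℂ (Elt M)) :=
  fun _ hT => hT.inner_nonneg_right x

theorem exists_star_mul_self {A : H →L[ℂ] H} (hA : A.IsPositive) : ∃ C, A = star C * C :=
  CStarAlgebra.nonneg_iff_eq_star_mul_self.1 ((nonneg_iff_isPositive A).2 hA)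

theorem apply_eq_zero_of_inner_eq_zero {A : H →L[ℂ] H} (hA : A.IsPositive) {x : H}
    (h : inner ℂ x (A x) = 0) : A x = 0 := by
  obtain ⟨C, rfl⟩ := exists_star_mul_self hA
  have hC : inner ℂ (C x) (C x) = 0 := by
    rwa [mul_apply_eq_comp, star_eq_adjoint, adjoint_inner_right] at h
  rw [mul_apply_eq_comp, inner_self_eq_zero.1 hC, map_zero]

variable {A B T : Elt M}

theorem isPos_star_mul_mul (hA : IsPos A) (T : Elt M) : IsPos (star T * A * T) :=
  IsPositive.adjoint_conj hA (T : H →L[ℂ] H)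

/-- Since `A x = 0`, any multiple `t ≥ 0` of the vector functional at `x` can be added to a
normalized one without changing its value at `A`. Boundedness in `t` forces `⟪T x, A T x⟫ = 0`. -/
theorem apply_eq_zero_of_mem_bounded (hA : IsPos A) (hT : T ∈ bounded A) {x : H}
    (hx : (A : H →L[ℂ] H) x = 0) : (A : H →L[ℂ] H) ((T : H →L[ℂ] H) x) = 0 := by
  by_cases hA0 : ∀ y, inner ℂ y ((A : H →L[ℂ] H) y) = 0
  · exact apply_eq_zero_of_inner_eq_zero hA (hA0 _)
  push Not at hA0
  obtain ⟨y, hy⟩ := hA0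
  set W := star T * A * T with hW
  have hWpos : IsPos W := isPos_star_mul_mul hA T
  set c : ℂ := inner ℂ y ((A : H →L[ℂ] H) y) with hc
  have hc0 : 0 ≤ c := hA.inner_nonneg_right y
  set r : ℂ := vectorFunctional x W with hr
  have hr0 : 0 ≤ r := isPosFunctional_vectorFunctional x W hWpos
  have hbound : ∀ t : ℝ, 0 ≤ t → t * r.re ≤ (seminorm A T).toReal ^ 2 := by
    intro t ht
    have ht' : (0 : ℂ) ≤ t := by exact_mod_cast ht
    have hcinv : 0 ≤ c⁻¹ := inv_nonneg.2 hc0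
    let f : StrongDual ℂ (Elt M) := c⁻¹ • vectorFunctional y + (t : ℂ) • vectorFunctional x
    have hfapp : ∀ V, f V = c⁻¹ * vectorFunctional y V + t * vectorFunctional x V := fun _ => rfl
    have hf : f ∈ states A := by
      refine ⟨fun V hV => ?_, ?_⟩
      · rw [hfapp]
        exact add_nonneg (mul_nonneg hcinv (isPosFunctional_vectorFunctional y V hV))
          (mul_nonneg ht' (isPosFunctional_vectorFunctional x V hV))
      · rw [hfapp, vectorFunctional_apply, vectorFunctional_apply, hx, inner_zero_right, mul_zero,
          add_zero]
        exact inv_mul_cancel₀ hy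
    have h1 : ENNReal.ofReal (√ (f W).re) ≤ seminorm A T :=
      le_iSup₂ (f := fun f (_ : f ∈ states A) => ENNReal.ofReal (√ (f (star T * A * T)).re)) f hf
    have h2 : √ (f W).re ≤ (seminorm A T).toReal := (ENNReal.ofReal_le_iff_le_toReal hT.ne).1 h1
    have h3 : (f W).re ≤ (seminorm A T).toReal ^ 2 := (Real.sqrt_le_left (by positivity)).1 h2
    refine le_trans ?_ h3
    rw [hfapp, Complex.add_re, Complex.re_ofReal_mul]
    exact le_add_of_nonneg_left (Complex.le_def.1
      (mul_nonneg hcinv (isPosFunctional_vectorFunctional y W hWpos))).1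
  have hr_re : r.re = 0 := by
    refine le_antisymm (not_lt.1 fun hlt => ?_) (Complex.le_def.1 hr0).1
    have := hbound (((seminorm A T).toReal ^ 2 + 1) / r.re) (by positivity)
    rw [div_mul_cancel₀ _ hlt.ne'] at this
    linarith
  have hr_zero : r = 0 := Complex.ext hr_re (Complex.le_def.1 hr0).2.symm
  refine apply_eq_zero_of_inner_eq_zero hA ?_
  rw [← hr_zero, hr, vectorFunctional_apply]
  simp [hW, star_eq_adjoint, adjoint_inner_right]

/-- The hypothesis puts `T* A T` in the form `A X A`. With `A = C* C` this is `C* D C ≤ ‖D‖ A`,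
where `D = C X C*`. -/
theorem mem_bounded_of_mul_eq (hA : IsPos A) (h : A * T * (B * A) = A * T) : T ∈ bounded A := by
  obtain ⟨C, hC⟩ := exists_star_mul_self hA
  set D : H →L[ℂ] H := C * ((star B * star T * A * T * B : Elt M) : H →L[ℂ] H) * star C with hD
  have hAs : star A = A := Subtype.ext hA.isSelfAdjoint
  have hW : star T * A * T = A * (star B * star T * A * T * B) * A := by
    have h' := congrArg star h
    simp only [star_mul, hAs] at h'
    calc star T * A * T = A * star B * (star T * A) * T := by rw [h']
      _ = A * star B * star T * (A * T) := by noncomm_ring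
      _ = A * star B * star T * (A * T * (B * A)) := by rw [h]
      _ = _ := by noncomm_ring
  have hDs : IsSelfAdjoint D := by
    have hX : IsSelfAdjoint (star B * star T * A * T * B) := by
      simp [IsSelfAdjoint, hAs, mul_assoc]
    exact (show IsSelfAdjoint ((star B * star T * A * T * B : Elt M) : H →L[ℂ] H) from
      congrArg Subtype.val hX).conjugate C
  have hle : star C * D * C ≤ ‖D‖ • (star C * C) := CStarAlgebra.star_left_conjugate_le_norm_smul hDs
  have hpos : IsPos (((‖D‖ : ℝ) : ℂ) • A - star T * A * T) := by
    have := (ContinuousLinearMap.le_def _ _).1 hle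
    unfold IsPos
    convert this using 1
    rw [hW, ← hC]
    have hAXA : ∀ X : H →L[ℂ] H, A * X * A = star C * (C * X * star C) * C := fun X => by
      rw [hC]; simp only [mul_assoc]
    exact congrArg (fun Y => ((‖D‖ : ℝ) : ℂ) • (A : H →L[ℂ] H) - Y) (hAXA _)
  refine lt_of_le_of_lt (b := ENNReal.ofReal √‖D‖) (iSup₂_le fun f hf => ?_) ENNReal.ofReal_lt_top
  refine ENNReal.ofReal_le_ofReal (Real.sqrt_le_sqrt ?_)
  have := (Complex.le_def.1 (hf.1 _ hpos)).1
  rw [map_sub, map_smul, hf.2] at this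
  simpa using this

theorem mem_bounded_iff (hA : IsPos A) (hABA : A * B * A = A) :
    T ∈ bounded A ↔ A * T * (B * A) = A * T := by
  refine ⟨fun hT => Subtype.ext (ContinuousLinearMap.ext fun x => ?_), mem_bounded_of_mul_eq hA⟩
  have hx : (A : H →L[ℂ] H) (x - (B : H →L[ℂ] H) ((A : H →L[ℂ] H) x)) = 0 := by
    rw [map_sub, sub_eq_zero]
    exact (DFunLike.congr_fun (congrArg Subtype.val hABA) x).symm
  have := apply_eq_zero_of_mem_bounded hA hT hx
  rw [map_sub, map_sub, sub_eq_zero] at this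
  exact this.symm

end ASpectrum
end

/-! ### From the `A`-spectrum to ordinary invertibility -/

noncomputable section
namespace ASpectrum

variable {H : Type*} [NormedAddCommGroup H] [InnerProductSpace ℂ H] [CompleteSpace H]
variable {M : VonNeumannAlgebra H} {A B S T : Elt M}

/-- For `z ≠ 0` and with `P = B A`, the `A`-invertibility of `z - T` amounts to the invertibility
of `z - P T P`. -/
theorem isAInvertible_smul_one_sub_iff (hA : IsPos A) (hABA : A * B * A = A)
    (hT : T ∈ bounded A) {z : ℂ} (hz : z ≠ 0) :
    IsAInvertible A (z • 1 - T) ↔ IsUnit (z • 1 - B * A * T * (B * A)) := by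
  have hbd := fun V : Elt M => mem_bounded_iff (T := V) hA hABA
  obtain ⟨P, hP⟩ : ∃ P, P = B * A := ⟨_, rfl⟩
  rw [← hP] at hbd ⊢
  have hAP : A * P = A := by rw [hP, ← mul_assoc, hABA]
  have hPP : P * P = P := by nth_rewrite 1 [hP]; rw [mul_assoc, hAP, ← hP]
  have hPV : ∀ V, V ∈ bounded A ↔ P * V * P = P * V := fun V => by
    rw [hbd]
    constructor
    · intro h
      have := congrArg (B * ·) h
      simpa only [← mul_assoc, ← hP] using this
    · intro h
      have := congrArg (A * ·) h
      simpa only [← mul_assoc, hAP] using this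
  have hT' := (hPV T).1 hT
  rw [hT']
  constructor
  · rintro ⟨R, hR, h1, h2⟩
    have hR' := (hPV R).1 hR
    have h1' : P * (z • 1 - T) * R = P := by
      have := congrArg (B * ·) h1
      simpa only [← mul_assoc, ← hP] using this
    have h2' : P * R * (z • 1 - T) = P := by
      have := congrArg (B * ·) h2
      simpa only [← mul_assoc, ← hP] using this
    have h1z : P * T * R = z • (P * R) - P := by
      rw [mul_sub, sub_mul, mul_smul_comm, mul_one, smul_mul_assoc] at h1'
      rw [eq_sub_iff_add_eq, add_comm]; exact (sub_eq_iff_eq_add.1 h1').symm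
    have h2z : P * R * T = z • (P * R) - P := by
      rw [mul_sub, mul_smul_comm, mul_one] at h2'
      rw [eq_sub_iff_add_eq, add_comm]; exact (sub_eq_iff_eq_add.1 h2').symm
    -- The inverse is assembled from `P R` on the corner of `P` and `z⁻¹` on the complement.
    refine ⟨⟨z • 1 - P * T, P * R + z⁻¹ • (1 - P), ?_, ?_⟩, rfl⟩
    · have e1 : P * T * (P * R) = z • (P * R) - P := by rw [← mul_assoc, hT', h1z]
      have e2 : P * T * (1 - P) = 0 := by rw [mul_sub, mul_one, hT', sub_self]
      rw [sub_mul, mul_add, mul_add, smul_one_mul, smul_one_mul, e1, mul_smul_comm, e2, smul_zero,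
        smul_smul, mul_inv_cancel₀ hz, one_smul]
      abel
    · have e1 : P * R * (P * T) = z • (P * R) - P := by rw [← mul_assoc, hR', h2z]
      have e2 : (1 - P) * (P * T) = 0 := by rw [← mul_assoc, sub_mul, one_mul, hPP, sub_self,
        zero_mul]
      rw [mul_sub, add_mul, add_mul, mul_smul_comm, mul_one, smul_mul_assoc, mul_smul_comm, mul_one,
        e1, smul_mul_assoc, e2, smul_zero, smul_smul, inv_mul_cancel₀ hz, one_smul]
      abel
  · rintro ⟨u, hu⟩
    have huP : (u : Elt M) * P = P * (z • 1 - T) * P := by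
      rw [hu, mul_sub, sub_mul, sub_mul, hT', mul_smul_comm, mul_one, smul_mul_assoc,
        smul_mul_assoc, one_mul, hPP]
    have hPu : P * (u : Elt M) = P * (z • 1 - T) * P := by
      rw [hu, mul_sub, mul_sub, sub_mul, ← mul_assoc, hPP, hT', mul_smul_comm, mul_one,
        smul_mul_assoc, hPP]
    have hcomm : Commute P (u : Elt M) := hPu.trans huP.symm
    have hcomm' : P * (↑u⁻¹ : Elt M) = ↑u⁻¹ * P := hcomm.units_inv_right.eq
    have hzT : P * (z • 1 - T) = P * u := by
      rw [hPu, mul_sub, sub_mul, hT', mul_smul_comm, mul_one, smul_mul_assoc, hPP]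
    refine ⟨P * ↑u⁻¹, (hPV _).2 ?_, ?_, ?_⟩
    · rw [← mul_assoc, hPP, hcomm', mul_assoc, hPP]
    · calc A * (z • 1 - T) * (P * ↑u⁻¹) = A * (P * (z • 1 - T)) * (P * ↑u⁻¹) := by
            rw [← mul_assoc A P, hAP]
        _ = A * (P * (↑u * ↑u⁻¹)) * P := by rw [hzT, hcomm']; noncomm_ring
        _ = A := by rw [Units.mul_inv, mul_one, hAP, hAP]
    · calc A * (P * ↑u⁻¹) * (z • 1 - T) = A * ↑u⁻¹ * (P * (z • 1 - T)) := by
            rw [hcomm']; noncomm_ring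
        _ = A * (↑u⁻¹ * ↑u) * P := by rw [hzT, hcomm.eq]; noncomm_ring
        _ = A := by rw [Units.inv_mul, mul_one, hAP]

/-- For an `A`-bounded `R`, `A R = A R B A`, so `A R U` depends on `U` only through `A U`. -/
theorem isAInvertible_congr (hA : IsPos A) (hABA : A * B * A = A) {V W : Elt M}
    (h : A * V = A * W) (hV : IsAInvertible A V) : IsAInvertible A W := by
  obtain ⟨R, hR, h1, h2⟩ := hV
  refine ⟨R, hR, by rw [← h, h1], ?_⟩
  have hR' := (mem_bounded_iff hA hABA).1 hR
  have key : ∀ U, A * R * U = A * R * B * (A * U) := fun U => by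
    calc A * R * U = A * R * (B * A) * U := by rw [hR']
      _ = _ := by simp only [mul_assoc]
  rw [key, ← h, ← key, h2]

theorem mul_mem_bounded (hA : IsPos A) (hABA : A * B * A = A) (hS : S ∈ bounded A)
    (hT : T ∈ bounded A) : S * T ∈ bounded A := by
  rw [mem_bounded_iff hA hABA] at *
  calc A * (S * T) * (B * A) = A * S * T * (B * A) := by noncomm_ring
    _ = A * S * (B * A) * T * (B * A) := by rw [hS]
    _ = A * S * B * (A * T * (B * A)) := by noncomm_ring
    _ = A * S * (B * A) * T := by rw [hT]; noncomm_ring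
    _ = A * (S * T) := by rw [hS, mul_assoc]

theorem sameInvertibility_of_aSpectrum_eq (hA : IsPos A)
    (hABA : A * B * A = A) (hS : S ∈ bounded A) (hT : T ∈ bounded A)
    (h : ∀ X ∈ bounded A, aSpectrum A (S * X) = aSpectrum A (T * X)) :
    SameInvertibility (B * A * S * (B * A)) (B * A * T * (B * A)) := by
  intro x
  have hABA' : A * (B * A) = A := by rw [← mul_assoc, hABA]
  have hPP : B * A * (B * A) = B * A := by rw [mul_assoc, hABA']
  -- Compressing an arbitrary `x` by `P` gives an `A`-bounded test element, so the hypothesis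
  -- reaches all of `M`.
  set X := B * A * x * (B * A) with hXdef
  have hX : X ∈ bounded A := (mem_bounded_iff hA hABA).2 (by
    rw [hXdef, mul_assoc A, mul_assoc _ (B * A) (B * A), hPP])
  have key : ∀ V ∈ bounded A,
      IsAInvertible A ((1 : ℂ) • 1 - V * X) ↔ IsUnit (1 - B * A * V * (B * A) * x) := by
    intro V hV
    rw [isAInvertible_smul_one_sub_iff hA hABA (mul_mem_bounded hA hABA hV hX) one_ne_zero,
      one_smul]
    have e : B * A * (V * X) * (B * A) = B * A * V * (B * A) * x * (B * A) := by
      rw [hXdef]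
      calc _ = B * A * V * (B * A) * x * (B * A * (B * A)) := by noncomm_ring
        _ = _ := by rw [hPP]
    -- The swap carries the trailing `P` to the front, where idempotency absorbs it.
    rw [e, isUnit_one_sub_mul_swap]
    have e' : B * A * (B * A * V * (B * A) * x) = B * A * V * (B * A) * x := by
      simp only [← mul_assoc]
      rw [mul_assoc (B * A) B A, hPP]
    rw [e']
  rw [← key S hS, ← key T hT]
  have := Set.ext_iff.1 (h X hX) 1
  exact not_iff_not.1 this

end ASpectrum
end

theorem theorem3p4 {H : Type*} [NormedAddCommGroup H] [InnerProductSpace ℂ H] [CompleteSpace H]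
    (M : VonNeumannAlgebra H) (A : ASpectrum.Elt M) (hA : ASpectrum.IsPos A)
    (hws : ASpectrum.IsWellSupported A) (S T : ASpectrum.Elt M)
    (hS : S ∈ ASpectrum.bounded A) (hT : T ∈ ASpectrum.bounded A) :
    (∀ X ∈ ASpectrum.bounded A,
        ASpectrum.aSpectrum A (S * X) = ASpectrum.aSpectrum A (T * X)) ↔
      A * S = A * T := by
  have hAs : IsSelfAdjoint A := Subtype.ext hA.isSelfAdjoint
  have : IsStarNormal A := hAs.isStarNormal
  obtain ⟨B, hABA⟩ := ASpectrum.exists_mul_mul_eq_of_isClosed_spectrum_diff hws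
  constructor
  · intro h
    have heq := (ASpectrum.sameInvertibility_of_aSpectrum_eq hA hABA hS hT h).eq
      ASpectrum.hasSupportProjections
    have key : ∀ V ∈ ASpectrum.bounded A, A * (B * A * V * (B * A)) = A * V := fun V hV => by
      rw [← (ASpectrum.mem_bounded_iff hA hABA).1 hV]
      simp only [← mul_assoc, hABA]
    rw [← key S hS, heq, key T hT]
  · intro h X _
    have hz : ∀ z : ℂ, A * (z • 1 - S * X) = A * (z • 1 - T * X) := fun z => by
      rw [mul_sub, mul_sub, ← mul_assoc, ← mul_assoc, h]
    ext z
    exact not_congr ⟨ASpectrum.isAInvertible_congr hA hABA (hz z),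
      ASpectrum.isAInvertible_congr hA hABA (hz z).symm⟩
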